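/- Let $(M,h)$ be a closed Riemannian spin manifold of arbitrary dimension with Levi-Civita connection $\nabla$, and let $\Sigma M$ be its spinor bundle with its hermitian metric $\langle\cdot,\cdot\rangle$ (complex linear in the second argument), Clifford multiplication and spin connection $\nabla^{\Sigma M}$. More generally, $M$ may be any closed Riemannian manifold and $\Sigma M$ any Dirac bundle over it, that is, a complex vector bundle of finite rank with a smooth hermitian metric, a smooth Clifford multiplication satisfying $\langle\psi,X\cdot\eta\rangle=-\langle X\cdot\psi,\eta\rangle$ and $X\cdot Y\cdot\psi+Y\cdot X\cdot\psi=-2h(X,Y)\psi$, and a smooth hermitian connection satisfying $\nabla^{\Sigma M}_Y(X\cdot\psi)=(\nabla_YX)\cdot\psi+X\cdot\nabla^{\Sigma M}_Y\psi$. Let $D=\sum_\alpha e_\alpha\cdot\nabla^{\Sigma M}_{e_\alpha}$ be the Dirac operator, where $(e_\alpha)$ denotes an orthonormal basis of $T_xM$, and let $\Delta=\operatorname{div}\operatorname{grad}$. Let $n\ge 0$, let $\kappa\in\mathbb{R}$, and let $(\phi,\psi)$ be a smooth $\kappa$-Dirac-harmonic map from $M$ to the round unit sphere $S^n\subset\mathbb{R}^{n+1}$.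 That is, $\phi=(\phi^1,\dots,\phi^{n+1})\colon M\to S^n$ is a smooth map, $\psi=(\psi^1,\dots,\psi^{n+1})$ is a smooth section of $\Sigma M\otimes\phi^\ast TS^n\subset\Sigma M\otimes\mathbb{R}^{n+1}$ (so the $\psi^i$ are smooth sections of $\Sigma M$ with $\sum_i\phi^i\psi^i=0$), and, with $\phi^j_\alpha=d\phi^j(e_\alpha)$, for all $i=1,\dots,n+1$, $$-\Delta\phi^i=|d\phi|^2\phi^i+\sum_{\alpha,j}\operatorname{Re}\langle\psi^i,e_\alpha\cdot\psi^j\rangle\,\phi^j_\alpha,$$ $$D\psi^i=-\sum_{\alpha,j}\phi^j_\alpha\,\phi^i\,e_\alpha\cdot\psi^j-2\kappa\Big(|\psi|^2\psi^i-\sum_j\langle\psi^j,\psi^i\rangle\psi^j\Big),\qquad |\psi|^2=\sum_j|\psi^j|^2 .$$ Then for all $i,m\in\{1,\dots,n+1\}$ the vector field $J^{im}=\sum_\alpha J^{im}_\alpha e_\alpha$ on $M$ with $$J_\alpha^{im}=\operatorname{Re}\langle e_\alpha\cdot\psi^i,\psi^m\rangle+\phi^i_\alpha\phi^m-\phi^i\phi^m_\alpha$$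 is smooth and divergence free, i.e. $\operatorname{div}J^{im}=\sum_\alpha h(\nabla_{e_\alpha}J^{im},e_\alpha)=0$ on $M$. -/

import Mathlib

open Bundle Manifold Module
open scoped ContDiff

noncomputable section

namespace KappaDirac

section Sections

variable {E : Type*} [NormedAddCommGroup E] [NormedSpace ℝ E]
  {H : Type*} [TopologicalSpace H] (I : ModelWithCorners ℝ E H)
  {M : Type*} [TopologicalSpace M] [ChartedSpace H M]
  (F : Type*) [NormedAddCommGroup F] [NormedSpace ℝ F]
  {V : M → Type*} [TopologicalSpace (TotalSpace F V)] [∀ x, TopologicalSpace (V x)]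
  [FiberBundle F V]

/-- The section `σ` of `V` is smooth at `x`. -/
abbrev SmoothAt (σ : Π x : M, V x) (x : M) : Prop :=
  ContMDiffAt I (I.prod 𝓘(ℝ, F)) ∞ (fun y ↦ TotalSpace.mk' F y (σ y)) x

/-- The section `σ` of `V` is differentiable at `x`. -/
abbrev DiffAt (σ : Π x : M, V x) (x : M) : Prop :=
  MDifferentiableAt I (I.prod 𝓘(ℝ, F)) (fun y ↦ TotalSpace.mk' F y (σ y)) x

end Sections

section Riemannian

variable {E : Type*} [NormedAddCommGroup E] [NormedSpace ℝ E] [FiniteDimensional ℝ E]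
  {H : Type*} [TopologicalSpace H] {I : ModelWithCorners ℝ E H}
  {M : Type*} [TopologicalSpace M] [ChartedSpace H M] [IsManifold I ∞ M]

instance instFiniteDimensionalTangentSpace (x : M) : FiniteDimensional ℝ (TangentSpace I x) :=
  inferInstanceAs (FiniteDimensional ℝ E)

/-- The Levi-Civita connection of the Riemannian metric: the metric, torsion-free connection on
the tangent bundle. -/
structure IsLeviCivita [RiemannianBundle (fun x : M ↦ TangentSpace I x)]
    (nabla : CovariantDerivative I E (fun x : M ↦ TangentSpace I x)) : Prop where
  /-- `v (h (X, Y)) = h (∇_v X, Y) + h (X, ∇_v Y)`. -/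
  metric (X Y : Π x : M, TangentSpace I x) (x : M)
    (hX : DiffAt I E X x) (hY : DiffAt I E Y x) (v : TangentSpace I x) :
    mvfderiv I (fun y ↦ inner ℝ (X y) (Y y)) x v =
      inner ℝ (nabla X x v) (Y x) + inner ℝ (X x) (nabla Y x v)
  torsion_free : nabla.torsion = 0

/-- The divergence of a vector field, the trace of `v ↦ ∇_v X`. In an orthonormal basis this is
`∑ α, h (∇_{e α} X, e α)`. -/
def divergence (nabla : CovariantDerivative I E (fun x : M ↦ TangentSpace I x))
    (X : Π x : M, TangentSpace I x) (x : M) : ℝ :=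
  LinearMap.trace ℝ (TangentSpace I x) (nabla X x : TangentSpace I x →ₗ[ℝ] TangentSpace I x)

variable [RiemannianBundle (fun x : M ↦ TangentSpace I x)]

variable (I) in
/-- An orthonormal basis `e α` of the tangent space at `x`. All the expressions below in which it
appears are contractions that do not depend on the choice of the basis. -/
def frame (x : M) :
    OrthonormalBasis (Fin (finrank ℝ (TangentSpace I x))) ℝ (TangentSpace I x) :=
  stdOrthonormalBasis ℝ (TangentSpace I x)

variable (I) in
/-- The vector field `∑ α, θ (e α) e α` that is metrically dual to a one-form `θ`. -/
def sharp (θ : Π x : M, TangentSpace I x →ₗ[ℝ] ℝ) (x : M) : TangentSpace I x :=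
  ∑ α, θ x (frame I x α) • frame I x α

/-- The Laplace-Beltrami operator `Δ f = div (grad f)` (a non-positive operator). -/
def laplacian (nabla : CovariantDerivative I E (fun x : M ↦ TangentSpace I x))
    (f : M → ℝ) (x : M) : ℝ :=
  divergence nabla (sharp I fun y ↦ (mvfderiv I f y : TangentSpace I y →ₗ[ℝ] ℝ)) x

end Riemannian

section Spinors

variable {E : Type*} [NormedAddCommGroup E] [NormedSpace ℝ E] [FiniteDimensional ℝ E]
  {H : Type*} [TopologicalSpace H] {I : ModelWithCorners ℝ E H}
  {M : Type*} [TopologicalSpace M] [ChartedSpace H M] [IsManifold I ∞ M]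
  [RiemannianBundle (fun x : M ↦ TangentSpace I x)]
  {F : Type*} [NormedAddCommGroup F] [NormedSpace ℂ F] [FiniteDimensional ℂ F]
  {S : M → Type*} [TopologicalSpace (TotalSpace F S)]
  [∀ x, NormedAddCommGroup (S x)] [∀ x, InnerProductSpace ℂ (S x)]
  [FiberBundle F S] [VectorBundle ℝ F S]
  [ContMDiffVectorBundle ∞ F S I]

variable (F S) in
/-- A Dirac bundle: a hermitian vector bundle `S` with a smooth, skew-hermitian Clifford
multiplication by tangent vectors and a smooth hermitian connection, which is compatible with
Clifford multiplication and the connection `nabla` of the tangent bundle. The spinor bundle of a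
Riemannian spin manifold, with the Levi-Civita connection `nabla` and the connection that it
induces on spinors, is of this kind. -/
structure DiracBundle
    (nabla : CovariantDerivative I E (fun x : M ↦ TangentSpace I x)) where
  /-- Clifford multiplication `X · ψ`. -/
  clifford (x : M) : TangentSpace I x →ₗ[ℝ] S x →ₗ[ℂ] S x
  /-- The connection on spinors. -/
  conn : CovariantDerivative I F S
  /-- The hermitian metric is smooth. -/
  inner_smooth (ψ η : Π x, S x) (x : M) (hψ : SmoothAt I F ψ x) (hη : SmoothAt I F η x) :
    ContMDiffAt I 𝓘(ℝ, ℂ) ∞ (fun y ↦ inner ℂ (ψ y) (η y)) x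
  /-- `⟨ψ, X · η⟩ = - ⟨X · ψ, η⟩`. -/
  clifford_skew (x : M) (X : TangentSpace I x) (ψ η : S x) :
    inner ℂ ψ (clifford x X η) = -inner ℂ (clifford x X ψ) η
  /-- `X · Y · ψ + Y · X · ψ = -2 h (X, Y) ψ`. -/
  clifford_relation (x : M) (X Y : TangentSpace I x) (ψ : S x) :
    clifford x X (clifford x Y ψ) + clifford x Y (clifford x X ψ) = (-2 * inner ℝ X Y : ℝ) • ψ
  /-- Clifford multiplication is smooth. -/
  clifford_smooth (X : Π x : M, TangentSpace I x) (ψ : Π x, S x) (x : M)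
    (hX : SmoothAt I E X x) (hψ : SmoothAt I F ψ x) :
    SmoothAt I F (fun y ↦ clifford y (X y) (ψ y)) x
  /-- The connection is smooth. -/
  conn_smooth : CovariantDerivative.ContMDiffCovariantDerivative conn ∞
  /-- The connection is complex linear. -/
  conn_smul (a : ℂ) (ψ : Π x, S x) (x : M) (hψ : DiffAt I F ψ x) (v : TangentSpace I x) :
    conn (fun y ↦ a • ψ y) x v = a • conn ψ x v
  /-- `v ⟨ψ, η⟩ = ⟨∇_v ψ, η⟩ + ⟨ψ, ∇_v η⟩`. -/
  conn_metric (ψ η : Π x, S x) (x : M)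
    (hψ : DiffAt I F ψ x) (hη : DiffAt I F η x) (v : TangentSpace I x) :
    mvfderiv I (fun y ↦ inner ℂ (ψ y) (η y)) x v =
      inner ℂ (conn ψ x v) (η x) + inner ℂ (ψ x) (conn η x v)
  /-- `∇_v (X · ψ) = (∇_v X) · ψ + X · ∇_v ψ`. -/
  conn_clifford (X : Π x : M, TangentSpace I x) (ψ : Π x, S x) (x : M)
    (hX : DiffAt I E X x) (hψ : DiffAt I F ψ x) (v : TangentSpace I x) :
    conn (fun y ↦ clifford y (X y) (ψ y)) x v =
      clifford x (nabla X x v) (ψ x) + clifford x (X x) (conn ψ x v)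

variable {nabla : CovariantDerivative I E (fun x : M ↦ TangentSpace I x)}

/-- The Dirac operator `∑ α, e α · ∇_{e α} ψ`. -/
def dirac (D : DiracBundle F S nabla) (ψ : Π x, S x) (x : M) : S x :=
  ∑ α, D.clifford x (frame I x α) (D.conn ψ x (frame I x α))

/-- The `i`-th component of a map into the unit sphere of `ℝ^(n+1)`. -/
def comp {n : ℕ} (φ : M → Metric.sphere (0 : EuclideanSpace ℝ (Fin (n + 1))) 1)
    (i : Fin (n + 1)) (x : M) : ℝ :=
  (φ x : EuclideanSpace ℝ (Fin (n + 1))) i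

/-- A smooth `κ`-Dirac-harmonic map `(φ, ψ)` into the unit sphere `S^n ⊂ ℝ^(n+1)`. The vector
spinor `ψ`, a section of `S ⊗ φ^* T S^n ⊂ S ⊗ ℝ^(n+1)`, is given by its components
`ψ 0, …, ψ n`, which are sections of `S`. -/
structure IsKappaDiracHarmonic {n : ℕ} (D : DiracBundle F S nabla) (κ : ℝ)
    (φ : M → Metric.sphere (0 : EuclideanSpace ℝ (Fin (n + 1))) 1)
    (ψ : Fin (n + 1) → Π x, S x) : Prop where
  smooth_map : ContMDiff I (𝓡 n) ∞ φ
  smooth_spinor (i : Fin (n + 1)) (x : M) : SmoothAt I F (ψ i) x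
  /-- `ψ` takes values in `S ⊗ φ^* T S^n`. -/
  tangent (x : M) : ∑ i, comp φ i x • ψ i x = 0
  /-- `-Δ φ^i = |dφ|² φ^i + Re ⟨ψ^i, e_α · ψ^j⟩ φ^j_α`. -/
  map_eq (i : Fin (n + 1)) (x : M) :
    -laplacian nabla (comp φ i) x =
      (∑ α, ∑ j, mvfderiv I (comp φ j) x (frame I x α) ^ 2) * comp φ i x +
      ∑ α, ∑ j, (inner ℂ (ψ i x) (D.clifford x (frame I x α) (ψ j x))).re *
        mvfderiv I (comp φ j) x (frame I x α)
  /-- `∂̸ ψ^i = -φ^j_α φ^i e_α · ψ^j - 2 κ (|ψ|² ψ^i - ⟨ψ^j, ψ^i⟩ ψ^j)`. -/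
  spinor_eq (i : Fin (n + 1)) (x : M) :
    dirac D (ψ i) x =
      -(∑ α, ∑ j, (mvfderiv I (comp φ j) x (frame I x α) * comp φ i x) •
          D.clifford x (frame I x α) (ψ j x)) -
      (2 * κ) • ((∑ j, ‖ψ j x‖ ^ 2) • ψ i x - ∑ j, inner ℂ (ψ j x) (ψ i x) • ψ j x)

/-- The one-form `v ↦ Re ⟨v · ψ^i, ψ^m⟩ + dφ^i(v) φ^m - φ^i dφ^m(v)`, whose value at `e α` is
the component `J_α^{im}`. -/
def currentForm {n : ℕ} (D : DiracBundle F S nabla)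
    (φ : M → Metric.sphere (0 : EuclideanSpace ℝ (Fin (n + 1))) 1)
    (ψ : Fin (n + 1) → Π x, S x) (i m : Fin (n + 1)) (x : M) : TangentSpace I x →ₗ[ℝ] ℝ where
  toFun v := (inner ℂ (D.clifford x v (ψ i x)) (ψ m x)).re +
    (mvfderiv I (comp φ i) x v * comp φ m x - comp φ i x * mvfderiv I (comp φ m) x v)
  map_add' v w := by
    simp only [map_add, LinearMap.add_apply, inner_add_left, Complex.add_re]
    ring
  map_smul' a v := by
    have h : inner ℂ (a • D.clifford x v (ψ i x)) (ψ m x) =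
        (a : ℂ) * inner ℂ (D.clifford x v (ψ i x)) (ψ m x) := by
      rw [← Complex.coe_smul, inner_smul_left, Complex.conj_ofReal]
    simp only [map_smul, LinearMap.smul_apply, h, Complex.re_ofReal_mul, smul_eq_mul,
      RingHom.id_apply]
    ring

/-- The Noether current, the vector field `J^{im} = ∑ α, J_α^{im} e α`. -/
def noetherCurrent {n : ℕ} (D : DiracBundle F S nabla)
    (φ : M → Metric.sphere (0 : EuclideanSpace ℝ (Fin (n + 1))) 1)
    (ψ : Fin (n + 1) → Π x, S x) (i m : Fin (n + 1)) : Π x : M, TangentSpace I x :=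
  sharp I (currentForm D φ ψ i m)

end Spinors

end KappaDirac

end

namespace KappaDirac

/-! `J^{im}` is the current attached to an infinitesimal rotation of the sphere. It splits
(`noetherCurrent_eq`) into the dual of `v ↦ Re ⟨v · ψ^i, ψ^m⟩` plus `φ^m grad φ^i - φ^i grad φ^m`.
Metric compatibility and skewness of Clifford multiplication give the first part the divergence `Re
⟨∂̸ψ^i, ψ^m⟩ - Re ⟨ψ^i, ∂̸ψ^m⟩` (`divergence_sharp_spinorForm`); the second has `φ^m Δφ^i - φ^i
Δφ^m` (`divergence_smul_grad_sub`). Put `Q_i = ∑ Re ⟨ψ^i, e_α · ψ^j⟩ φ^j_α`. The spinor equation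
turns the first divergence into `φ^m Q_i - φ^i Q_m`, since its `κ`-terms are symmetric in `i, m`.
The map equation turns the second into the negative of this, since the `|dφ|²` terms cancel.
Smoothness needs an argument of its own, because the orthonormal bases are chosen pointwise
(`smoothAt_sharp`). -/

theorem re_inner_real_smul_left {V : Type*} [NormedAddCommGroup V] [InnerProductSpace ℂ V]
    (a : ℝ) (v w : V) : (inner ℂ (a • v) w).re = a * (inner ℂ v w).re := by
  rw [← Complex.coe_smul, inner_smul_left, Complex.conj_ofReal, Complex.re_ofReal_mul]

/-! ### Metric duals of one-forms: smoothness and divergence. -/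

section Riemannian

variable {E : Type*} [NormedAddCommGroup E] [NormedSpace ℝ E]
  {H : Type*} [TopologicalSpace H] {I : ModelWithCorners ℝ E H}
  {M : Type*} [TopologicalSpace M] [ChartedSpace H M]

/-- The determinant of a matrix of smooth functions is smooth. -/
theorem contMDiffAt_det {ι : Type*} [Fintype ι] [DecidableEq ι] {A : M → Matrix ι ι ℝ} {x : M}
    (hA : ∀ i j, ContMDiffAt I 𝓘(ℝ, ℝ) ∞ (fun y ↦ A y i j) x) :
    ContMDiffAt I 𝓘(ℝ, ℝ) ∞ (fun y ↦ (A y).det) x := by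
  simp only [Matrix.det_apply']
  exact ContMDiffAt.sum fun σ _ ↦
    contMDiffAt_const.mul (ContMDiffAt.prod fun i _ ↦ hA (σ i) i)

theorem contMDiff_comp {n : ℕ} {φ : M → Metric.sphere (0 : EuclideanSpace ℝ (Fin (n + 1))) 1}
    (hφ : ContMDiff I (𝓡 n) ∞ φ) (i : Fin (n + 1)) : ContMDiff I 𝓘(ℝ, ℝ) ∞ (comp φ i) := by
  have : Fact (finrank ℝ (EuclideanSpace ℝ (Fin (n + 1))) = n + 1) := ⟨finrank_euclideanSpace_fin⟩
  exact (EuclideanSpace.proj (𝕜 := ℝ) i).contMDiff.comp (contMDiff_coe_sphere.comp hφ)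

section Dual

variable [FiniteDimensional ℝ E] [RiemannianBundle (fun x : M ↦ TangentSpace I x)]

/-- Characterizes the dual field without the frame, which need not depend continuously on the point.
-/
theorem inner_sharp (θ : Π x : M, TangentSpace I x →ₗ[ℝ] ℝ) (x : M) (v : TangentSpace I x) :
    inner ℝ (sharp I θ x) v = θ x v := by
  conv_rhs => rw [← (frame I x).sum_repr' v]
  simp only [sharp, sum_inner, real_inner_smul_left, map_sum, map_smul, smul_eq_mul]
  exact Finset.sum_congr rfl fun α _ ↦ mul_comm _ _

/-- The gradient of a function. -/
noncomputable def grad (f : M → ℝ) : Π x : M, TangentSpace I x :=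
  sharp I fun y ↦ (mvfderiv I f y : TangentSpace I y →ₗ[ℝ] ℝ)

theorem inner_grad (f : M → ℝ) (x : M) (v : TangentSpace I x) :
    inner ℝ (grad f x) v = mvfderiv I f x v :=
  inner_sharp _ x v

end Dual

variable [IsManifold I ∞ M]

/-- The derivative of a smooth function in the direction of a smooth vector field is smooth. -/
theorem contMDiffAt_mvfderiv_apply {f : M → ℝ} (hf : ContMDiff I 𝓘(ℝ, ℝ) ∞ f)
    {X : Π x : M, TangentSpace I x} {x : M} (hX : SmoothAt I E X x) :
    ContMDiffAt I 𝓘(ℝ, ℝ) ∞ (fun y ↦ mvfderiv I f y (X y)) x := by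
  have h : ContMDiffAt I 𝓘(ℝ, ℝ).tangent ∞
      (fun y ↦ tangentMap I 𝓘(ℝ, ℝ) f (TotalSpace.mk' E y (X y))) x :=
    (hf.contMDiff_tangentMap (m := ∞) (by simp)).contMDiffAt.comp x hX
  rw [contMDiffAt_totalSpace] at h
  simpa using! h.2

variable (nabla : CovariantDerivative I E (fun x : M ↦ TangentSpace I x))

theorem divergence_add {X Y : Π x : M, TangentSpace I x} {x : M}
    (hX : DiffAt I E X x) (hY : DiffAt I E Y x) :
    divergence nabla (X + Y) x = divergence nabla X x + divergence nabla Y x := by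
  rw [divergence, nabla.isCovariantDerivativeOnUniv.add hX hY]
  exact map_add (LinearMap.trace ℝ (TangentSpace I x)) _ _

variable [FiniteDimensional ℝ E]

theorem divergence_smul {X : Π x : M, TangentSpace I x} {f : M → ℝ} {x : M}
    (hf : MDifferentiableAt I 𝓘(ℝ, ℝ) f x) (hX : DiffAt I E X x) :
    divergence nabla (f • X) x = f x * divergence nabla X x + mvfderiv I f x (X x) := by
  rw [divergence, nabla.isCovariantDerivativeOnUniv.leibniz hX hf]
  have h : (((f x • nabla X x + (mvfderiv I f x).smulRight (X x) :
      TangentSpace I x →L[ℝ] TangentSpace I x)) : TangentSpace I x →ₗ[ℝ] TangentSpace I x) =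
      f x • (nabla X x : TangentSpace I x →ₗ[ℝ] TangentSpace I x) +
        (mvfderiv I f x : TangentSpace I x →ₗ[ℝ] ℝ).smulRight (X x) := rfl
  rw [h, map_add, map_smul, LinearMap.trace_smulRight]
  rfl

variable [RiemannianBundle (fun x : M ↦ TangentSpace I x)]

theorem divergence_eq_sum_inner (X : Π x : M, TangentSpace I x) (x : M) :
    divergence nabla X x = ∑ α, inner ℝ (nabla X x (frame I x α)) (frame I x α) := by
  rw [divergence, LinearMap.trace_eq_sum_inner _ (frame I x)]
  exact Finset.sum_congr rfl fun α _ ↦ real_inner_comm _ _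

variable {nabla} in
/-- `h (∇_v θ♯, X) = v (θ (X)) - θ (∇_v X)`. -/
theorem IsLeviCivita.inner_nabla_sharp (hnabla : IsLeviCivita nabla)
    {θ : Π x : M, TangentSpace I x →ₗ[ℝ] ℝ} {X : Π x : M, TangentSpace I x} {x : M}
    (hθ : DiffAt I E (sharp I θ) x) (hX : DiffAt I E X x) (v : TangentSpace I x) :
    inner ℝ (nabla (sharp I θ) x v) (X x) =
      mvfderiv I (fun y ↦ θ y (X y)) x v - θ x (nabla X x v) := by
  have h := hnabla.metric (sharp I θ) X x hθ hX v
  simp only [inner_sharp] at h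
  rw [h, add_sub_cancel_right]

variable [IsContMDiffRiemannianBundle I ∞ E (fun x : M ↦ TangentSpace I x)]

/-- The vector field dual to a one-form is smooth if the one-form takes smooth values on smooth
vector fields. -/
theorem smoothAt_sharp {θ : Π x : M, TangentSpace I x →ₗ[ℝ] ℝ} {x : M}
    (hθ : ∀ X : Π x : M, TangentSpace I x, SmoothAt I E X x →
      ContMDiffAt I 𝓘(ℝ, ℝ) ∞ (fun y ↦ θ y (X y)) x) :
    SmoothAt I E (sharp I θ) x := by
  -- In a smooth local frame `s`, the coefficients of the dual field solve a linear system with the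
  -- Gram matrix of `s`. Cramer's rule expresses them as quotients of determinants of smooth
  -- functions.
  set e := trivializationAt E (fun x : M ↦ TangentSpace I x) x
  have hx : x ∈ e.baseSet := FiberBundle.mem_baseSet_trivializationAt' x
  let b := finBasis ℝ E
  let s := e.localFrame b
  have hs : IsLocalFrameOn I E ∞ s e.baseSet := e.isLocalFrameOn_localFrame_baseSet I ∞ b
  have hsx (i) : SmoothAt I E (s i) x := hs.contMDiffAt e.open_baseSet hx i
  let G (y : M) := Matrix.gram ℝ (fun i ↦ s i y)
  let t (y : M) (i) : ℝ := θ y (s i y)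
  let c (y : M) (i) : ℝ := ((G y).updateCol i (t y)).det / (G y).det
  have hG (i j) : ContMDiffAt I 𝓘(ℝ, ℝ) ∞ (fun y ↦ G y i j) x :=
    ContMDiffAt.inner_bundle (E := fun x : M ↦ TangentSpace I x) (b := id) (hsx i) (hsx j)
  have hdet {y : M} (hy : y ∈ e.baseSet) : (G y).det ≠ 0 :=
    Matrix.det_gram_ne_zero_iff_linearIndependent.2 (hs.linearIndependent hy)
  have hc (i) : ContMDiffAt I 𝓘(ℝ, ℝ) ∞ (fun y ↦ c y i) x := by
    refine (contMDiffAt_det fun j k ↦ ?_).div₀ (contMDiffAt_det hG) (hdet hx)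
    by_cases hk : k = i
    · simpa [Matrix.updateCol_apply, hk, t] using hθ _ (hsx j)
    · simpa [Matrix.updateCol_apply, hk] using hG j k
  have hsum : SmoothAt I E (fun y ↦ ∑ i, c y i • s i y) x :=
    ContMDiffAt.sum_section fun i _ ↦ (hc i).smul_section (hsx i)
  refine hsum.congr_of_eventuallyEq ?_
  filter_upwards [e.open_baseSet.mem_nhds hx] with y hy
  congr 1
  -- It suffices to compare inner products with the frame vectors, which is the system `G c = t`.
  refine InnerProductSpace.ext_inner_left_basis (𝕜 := ℝ) (hs.toBasisAt hy) fun i ↦ ?_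
  have hcramer := congrFun (Matrix.mulVec_cramer (G y) (t y)) i
  simp only [Matrix.mulVec, dotProduct, Matrix.cramer_apply, Pi.smul_apply, smul_eq_mul] at hcramer
  rw [hs.toBasisAt_coe, real_inner_comm, inner_sharp, inner_sum]
  simp only [real_inner_smul_right, c, div_mul_eq_mul_div]
  rw [← Finset.sum_div, eq_div_iff (hdet hy), mul_comm, ← hcramer]
  exact Finset.sum_congr rfl fun k _ ↦ mul_comm _ _

theorem smoothAt_grad {f : M → ℝ} (hf : ContMDiff I 𝓘(ℝ, ℝ) ∞ f) (x : M) :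
    SmoothAt I E (grad (I := I) f) x :=
  smoothAt_sharp fun _ hX ↦ contMDiffAt_mvfderiv_apply hf hX

theorem smoothAt_smul_grad_sub {f g : M → ℝ} (hf : ContMDiff I 𝓘(ℝ, ℝ) ∞ f)
    (hg : ContMDiff I 𝓘(ℝ, ℝ) ∞ g) (x : M) :
    SmoothAt I E (g • grad (I := I) f + (-f) • grad (I := I) g) x :=
  ((hg x).smul_section (smoothAt_grad hf x)).add_section
    ((hf x).neg.smul_section (smoothAt_grad hg x))

/-- `div (g grad f - f grad g) = g Δ f - f Δ g`. -/
theorem divergence_smul_grad_sub {f g : M → ℝ} (hf : ContMDiff I 𝓘(ℝ, ℝ) ∞ f)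
    (hg : ContMDiff I 𝓘(ℝ, ℝ) ∞ g) (x : M) :
    divergence nabla (g • grad f + (-f) • grad g) x =
      g x * laplacian nabla f x - f x * laplacian nabla g x := by
  have hfx : MDifferentiableAt I 𝓘(ℝ, ℝ) f x := hf.contMDiffAt.mdifferentiableAt (by simp)
  have hgx : MDifferentiableAt I 𝓘(ℝ, ℝ) g x := hg.contMDiffAt.mdifferentiableAt (by simp)
  have hgf : DiffAt I E (grad f) x := (smoothAt_grad hf x).mdifferentiableAt (by simp)
  have hgg : DiffAt I E (grad g) x := (smoothAt_grad hg x).mdifferentiableAt (by simp)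
  rw [divergence_add nabla (hgx.smul_section hgf) (hfx.neg.smul_section hgg),
    divergence_smul nabla hgx hgf, divergence_smul nabla hfx.neg hgg, mvfderiv_neg]
  -- Both cross terms equal `h (grad f, grad g)`, so they cancel.
  have h : mvfderiv I f x (grad g x) = mvfderiv I g x (grad f x) := by
    rw [← inner_grad, ← inner_grad, real_inner_comm]
  change _ * laplacian nabla f x + _ + (-f x * laplacian nabla g x + -(mvfderiv I f x (grad g x))) =
    _
  rw [h]
  ring

end Riemannian

/-! ### The spinorial one-form and the Dirac operator. -/

section Spinors

variable {E : Type*} [NormedAddCommGroup E] [NormedSpace ℝ E]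
  {H : Type*} [TopologicalSpace H] {I : ModelWithCorners ℝ E H}
  {M : Type*} [TopologicalSpace M] [ChartedSpace H M] [IsManifold I ∞ M]
  [RiemannianBundle (fun x : M ↦ TangentSpace I x)]
  {F : Type*} [NormedAddCommGroup F] [NormedSpace ℂ F]
  {S : M → Type*} [TopologicalSpace (TotalSpace F S)]
  [∀ x, NormedAddCommGroup (S x)] [∀ x, InnerProductSpace ℂ (S x)]
  [FiberBundle F S] [VectorBundle ℝ F S]
  {nabla : CovariantDerivative I E (fun x : M ↦ TangentSpace I x)}
  (D : DiracBundle F S nabla)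

/-- The one-form `v ↦ Re ⟨v · ψ, η⟩`. -/
noncomputable def spinorForm (ψ η : Π x, S x) (x : M) : TangentSpace I x →ₗ[ℝ] ℝ where
  toFun v := (inner ℂ (D.clifford x v (ψ x)) (η x)).re
  map_add' v w := by simp only [map_add, LinearMap.add_apply, inner_add_left, Complex.add_re]
  map_smul' a v := by
    rw [map_smul, LinearMap.smul_apply, re_inner_real_smul_left, smul_eq_mul, RingHom.id_apply]

theorem spinorForm_apply (ψ η : Π x, S x) (x : M) (v : TangentSpace I x) :
    spinorForm D ψ η x v = (inner ℂ (D.clifford x v (ψ x)) (η x)).re := rfl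

theorem contMDiffAt_spinorForm_apply {ψ η : Π x, S x} {X : Π x : M, TangentSpace I x} {x : M}
    (hψ : SmoothAt I F ψ x) (hη : SmoothAt I F η x) (hX : SmoothAt I E X x) :
    ContMDiffAt I 𝓘(ℝ, ℝ) ∞ (fun y ↦ spinorForm D ψ η y (X y)) x :=
  Complex.reCLM.contMDiff.contMDiffAt.comp x
    (D.inner_smooth _ _ x (D.clifford_smooth X ψ x hX hψ) hη)

/-- `v (Re ⟨X · ψ, η⟩) = Re ⟨∇_v X · ψ, η⟩ + Re ⟨X · ∇_v ψ, η⟩ + Re ⟨X · ψ, ∇_v η⟩`. -/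
theorem mvfderiv_spinorForm_apply {ψ η : Π x, S x} {X : Π x : M, TangentSpace I x} {x : M}
    (hψ : SmoothAt I F ψ x) (hη : SmoothAt I F η x) (hX : SmoothAt I E X x)
    (v : TangentSpace I x) :
    mvfderiv I (fun y ↦ spinorForm D ψ η y (X y)) x v =
      spinorForm D ψ η x (nabla X x v) +
        (inner ℂ (D.clifford x (X x) (D.conn ψ x v)) (η x)).re +
        (inner ℂ (D.clifford x (X x) (ψ x)) (D.conn η x v)).re := by
  have hXψ := D.clifford_smooth X ψ x hX hψ
  have hdiff : MDifferentiableAt I 𝓘(ℝ, ℂ)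
      (fun y ↦ inner ℂ (D.clifford y (X y) (ψ y)) (η y)) x :=
    (D.inner_smooth _ _ x hXψ hη).mdifferentiableAt (by simp)
  have hre : mvfderiv I (fun y ↦ spinorForm D ψ η y (X y)) x v =
      (mvfderiv I (fun y ↦ inner ℂ (D.clifford y (X y) (ψ y)) (η y)) x v).re := by
    have h := mfderiv_comp_apply x (Complex.reCLM.differentiableAt.mdifferentiableAt
      (x := inner ℂ (D.clifford x (X x) (ψ x)) (η x))) hdiff v
    rw [mfderiv_eq_fderiv, Complex.reCLM.fderiv] at h
    exact h
  rw [hre, D.conn_metric _ _ x (hXψ.mdifferentiableAt (by simp)) (hη.mdifferentiableAt (by simp)),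
    D.conn_clifford X ψ x (hX.mdifferentiableAt (by simp)) (hψ.mdifferentiableAt (by simp)),
    inner_add_left]
  simp only [Complex.add_re, spinorForm_apply]

theorem currentForm_apply {n : ℕ}
    (φ : M → Metric.sphere (0 : EuclideanSpace ℝ (Fin (n + 1))) 1)
    (ψ : Fin (n + 1) → Π x, S x) (i m : Fin (n + 1)) (x : M) (v : TangentSpace I x) :
    currentForm D φ ψ i m x v = (inner ℂ (D.clifford x v (ψ i x)) (ψ m x)).re +
      (mvfderiv I (comp φ i) x v * comp φ m x - comp φ i x * mvfderiv I (comp φ m) x v) := rfl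

variable [FiniteDimensional ℝ E]

theorem noetherCurrent_eq {n : ℕ}
    (φ : M → Metric.sphere (0 : EuclideanSpace ℝ (Fin (n + 1))) 1)
    (ψ : Fin (n + 1) → Π x, S x) (i m : Fin (n + 1)) :
    noetherCurrent D φ ψ i m = sharp I (spinorForm D (ψ i) (ψ m)) +
      (comp φ m • grad (comp φ i) + (-comp φ i) • grad (comp φ m)) := by
  funext x
  refine ext_inner_right ℝ fun v ↦ ?_
  simp only [Pi.add_apply, Pi.smul_apply', Pi.neg_apply, inner_add_left, real_inner_smul_left,
    noetherCurrent, inner_sharp, inner_grad, spinorForm_apply]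
  rw [currentForm_apply]
  ring

/-- Isolates `φ^i` times the coupling term of the map equation for index `m`; the remaining `κ`-term
is symmetric in `i, m`. -/
theorem IsKappaDiracHarmonic.re_inner_dirac {n : ℕ} {κ : ℝ}
    {φ : M → Metric.sphere (0 : EuclideanSpace ℝ (Fin (n + 1))) 1} {ψ : Fin (n + 1) → Π x, S x}
    {D : DiracBundle F S nabla} (h : IsKappaDiracHarmonic D κ φ ψ) (i m : Fin (n + 1)) (x : M) :
    (inner ℂ (dirac D (ψ i) x) (ψ m x)).re =
      -(comp φ i x * ∑ α, ∑ j, (inner ℂ (ψ m x) (D.clifford x (frame I x α) (ψ j x))).re *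
        mvfderiv I (comp φ j) x (frame I x α)) -
      2 * κ * ((∑ j, ‖ψ j x‖ ^ 2) * (inner ℂ (ψ i x) (ψ m x)).re -
        ∑ j, (inner ℂ (ψ i x) (ψ j x) * inner ℂ (ψ j x) (ψ m x)).re) := by
  rw [h.spinor_eq]
  simp only [inner_sub_left, inner_neg_left, sum_inner, Complex.sub_re, Complex.neg_re,
    Complex.re_sum, re_inner_real_smul_left, inner_smul_left, inner_conj_symm, Finset.mul_sum]
  congr 2
  refine Finset.sum_congr rfl fun α _ ↦ Finset.sum_congr rfl fun j _ ↦ ?_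
  rw [← inner_conj_symm, Complex.conj_re]
  ring

variable [IsContMDiffRiemannianBundle I ∞ E (fun x : M ↦ TangentSpace I x)]

theorem smoothAt_sharp_spinorForm {ψ η : Π x, S x} {x : M}
    (hψ : SmoothAt I F ψ x) (hη : SmoothAt I F η x) :
    SmoothAt I E (sharp I (spinorForm D ψ η)) x :=
  smoothAt_sharp fun _ hX ↦ contMDiffAt_spinorForm_apply D hψ hη hX

/-- `div (Re ⟨e_α · ψ, η⟩ e_α) = Re ⟨∂̸ψ, η⟩ - Re ⟨ψ, ∂̸η⟩`. -/
theorem divergence_sharp_spinorForm (hnabla : IsLeviCivita nabla) {ψ η : Π x, S x} {x : M}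
    (hψ : SmoothAt I F ψ x) (hη : SmoothAt I F η x) :
    divergence nabla (sharp I (spinorForm D ψ η)) x =
      (inner ℂ (dirac D ψ x) (η x)).re - (inner ℂ (ψ x) (dirac D η x)).re := by
  rw [divergence_eq_sum_inner, dirac, dirac, sum_inner, inner_sum, Complex.re_sum, Complex.re_sum,
    ← Finset.sum_sub_distrib]
  refine Finset.sum_congr rfl fun α _ ↦ ?_
  set v := frame I x α
  -- Any smooth extension `X` of `v` will do: the terms `Re ⟨∇_v X · ψ, η⟩` cancel, so `∇X` need not
  -- vanish at `x`.
  have hX : SmoothAt I E (FiberBundle.extend E v) x := FiberBundle.contMDiffAt_extend ..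
  have h := hnabla.inner_nabla_sharp
    ((smoothAt_sharp_spinorForm D hψ hη).mdifferentiableAt (by simp))
    (hX.mdifferentiableAt (by simp)) v
  rw [mvfderiv_spinorForm_apply D hψ hη hX, FiberBundle.extend_apply_self] at h
  rw [h, D.clifford_skew, Complex.neg_re]
  ring

variable {n : ℕ} {D}

/-! ### Smoothness and conservation of the Noether current. -/

namespace IsKappaDiracHarmonic

variable {κ : ℝ} {φ : M → Metric.sphere (0 : EuclideanSpace ℝ (Fin (n + 1))) 1}
  {ψ : Fin (n + 1) → Π x, S x}

theorem smoothAt_noetherCurrent (h : IsKappaDiracHarmonic D κ φ ψ) (i m : Fin (n + 1)) (x : M) :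
    SmoothAt I E (noetherCurrent D φ ψ i m) x := by
  have hφ := contMDiff_comp h.smooth_map
  rw [noetherCurrent_eq]
  exact (smoothAt_sharp_spinorForm D (h.smooth_spinor i x) (h.smooth_spinor m x)).add_section
    (smoothAt_smul_grad_sub (hφ i) (hφ m) x)

theorem divergence_noetherCurrent (hnabla : IsLeviCivita nabla)
    (h : IsKappaDiracHarmonic D κ φ ψ) (i m : Fin (n + 1)) (x : M) :
    divergence nabla (noetherCurrent D φ ψ i m) x = 0 := by
  have hφ := contMDiff_comp h.smooth_map
  have hspin := smoothAt_sharp_spinorForm D (h.smooth_spinor i x) (h.smooth_spinor m x)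
  have hmap := smoothAt_smul_grad_sub (hφ i) (hφ m) x
  have hsymm (j k : Fin (n + 1)) : (inner ℂ (ψ j x) (ψ k x)).re = (inner ℂ (ψ k x) (ψ j x)).re := by
    rw [← inner_conj_symm, Complex.conj_re]
  -- Conjugating each summand exchanges `i` and `m` and preserves the real part.
  have hquartic : ∑ j, (inner ℂ (ψ m x) (ψ j x) * inner ℂ (ψ j x) (ψ i x)).re =
      ∑ j, (inner ℂ (ψ i x) (ψ j x) * inner ℂ (ψ j x) (ψ m x)).re := by
    refine Finset.sum_congr rfl fun j _ ↦ ?_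
    rw [← Complex.conj_re, map_mul, inner_conj_symm, inner_conj_symm, mul_comm]
  have hdirac : (inner ℂ (ψ i x) (dirac D (ψ m) x)).re =
      (inner ℂ (dirac D (ψ m) x) (ψ i x)).re := by
    rw [← inner_conj_symm, Complex.conj_re]
  rw [noetherCurrent_eq, divergence_add nabla (hspin.mdifferentiableAt (by simp))
    (hmap.mdifferentiableAt (by simp)), divergence_smul_grad_sub nabla (hφ i) (hφ m),
    divergence_sharp_spinorForm D hnabla (h.smooth_spinor i x) (h.smooth_spinor m x), hdirac,
    h.re_inner_dirac i m, h.re_inner_dirac m i, hquartic, hsymm m i]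
  -- The antisymmetric combination of the map equations removes `|dφ|² φ^i φ^m`.
  linear_combination comp φ i x * h.map_eq m x - comp φ m x * h.map_eq i x

end IsKappaDiracHarmonic

end Spinors

end KappaDirac

theorem mainTheorem4 {d n : ℕ}
    {M : Type*} [TopologicalSpace M] [T2Space M] [CompactSpace M]
    [ChartedSpace (EuclideanSpace ℝ (Fin d)) M] [IsManifold (𝓡 d) ∞ M]
    [RiemannianBundle (fun x : M ↦ TangentSpace (𝓡 d) x)]
    [IsContMDiffRiemannianBundle (𝓡 d) ∞ (EuclideanSpace ℝ (Fin d))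
      (fun x : M ↦ TangentSpace (𝓡 d) x)]
    (nabla : CovariantDerivative (𝓡 d) (EuclideanSpace ℝ (Fin d))
      (fun x : M ↦ TangentSpace (𝓡 d) x))
    (hnabla : KappaDirac.IsLeviCivita nabla)
    {F : Type*} [NormedAddCommGroup F] [NormedSpace ℂ F] [FiniteDimensional ℂ F]
    {S : M → Type*} [TopologicalSpace (TotalSpace F S)]
    [∀ x, NormedAddCommGroup (S x)] [∀ x, InnerProductSpace ℂ (S x)]
    [FiberBundle F S] [VectorBundle ℂ F S] [VectorBundle ℝ F S]
    [ContMDiffVectorBundle ∞ F S (𝓡 d)]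
    (D : KappaDirac.DiracBundle F S nabla) (κ : ℝ)
    (φ : M → Metric.sphere (0 : EuclideanSpace ℝ (Fin (n + 1))) 1)
    (ψ : Fin (n + 1) → Π x, S x)
    (h : KappaDirac.IsKappaDiracHarmonic D κ φ ψ) (i m : Fin (n + 1)) :
    (∀ x, KappaDirac.SmoothAt (𝓡 d) (EuclideanSpace ℝ (Fin d))
        (KappaDirac.noetherCurrent D φ ψ i m) x) ∧
      ∀ x, KappaDirac.divergence nabla (KappaDirac.noetherCurrent D φ ψ i m) x = 0 := by
  exact ⟨h.smoothAt_noetherCurrent i m, h.divergence_noetherCurrent hnabla i m⟩
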